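/- Let $\mathsf T$ be an essentially small triangulated category. Let $\mathbf A(\mathsf T)$ be its abelianisation, i.e. the category of additive functors $F\colon\mathsf T^{\mathrm{op}}\to\mathsf{Ab}$ that fit into an exact sequence $\operatorname{Hom}_{\mathsf T}(-,X)\to\operatorname{Hom}_{\mathsf T}(-,Y)\to F\to 0$ with $X,Y\in\mathsf T$. Assume that - $\mathsf T$ is finitely generated: there is an object $X$ such that $\mathsf T=\operatorname{Thick}(X)$, the smallest thick subcategory (full triangulated subcategory closed under direct summands) of $\mathsf T$ containing $X$; and - $\mathsf T$ is locally noetherian: idempotents in $\mathsf T$ split, and every object of $\mathbf A(\mathsf T)$ is noetherian, i.e. every ascending chain of subobjects in $\mathbf A(\mathsf T)$ eventually stabilises. Then the lattice $\mathbf T(\mathsf T)$ of thick subcategories of $\mathsf T$, ordered by inclusion, is noetherian: there is no infinite strictly increasing chain $\mathsf U_0\subsetneq\mathsf U_1\subsetneq\mathsf U_2\subsetneq\cdots$ of thick subcategories of $\mathsf T$. -/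

import Mathlib

open CategoryTheory CategoryTheory.Limits

universe v u

namespace ThickLattice

section Abelianisation

variable (C : Type u) [Category.{v} C] [Preadditive C]

/-- The property of a functor `F : Cᵒᵖ ⥤ Ab` of being additive and fitting into an exact sequence
`Hom(-,X) ⟶ Hom(-,Y) ⟶ F ⟶ 0`. -/
def abelianisationProp : ObjectProperty (Cᵒᵖ ⥤ AddCommGrpCat.{v}) := fun F =>
  F.Additive ∧
    ∃ (X Y : C) (α : preadditiveYoneda.obj X ⟶ preadditiveYoneda.obj Y)
      (π : preadditiveYoneda.obj Y ⟶ F) (w : α ≫ π = 0),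
      (ShortComplex.mk α π w).Exact ∧ Epi π

/-- The abelianisation `A(C)`: the full subcategory of the category of functors `Cᵒᵖ ⥤ Ab`
on the additive functors `F` with an exact sequence `Hom(-,X) ⟶ Hom(-,Y) ⟶ F ⟶ 0`. -/
abbrev Abelianisation := (abelianisationProp C).FullSubcategory

/-- `C` is locally noetherian: idempotents in `C` split, and every object of the abelianisation
`A(C)` satisfies the ascending chain condition on subobjects in `A(C)`. -/
structure IsLocallyNoetherian : Prop where
  isIdempotentComplete : IsIdempotentComplete C
  isNoetherianObject : ∀ F : Abelianisation C, IsNoetherianObject F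

end Abelianisation

section Thick

variable (C : Type u) [Category.{v} C] [Preadditive C] [HasZeroObject C] [HasShift C ℤ]
  [∀ n : ℤ, (shiftFunctor C n).Additive] [Pretriangulated C]

/-- Thick subcategories of `C`, i.e. (strictly) full triangulated subcategories which are closed
under direct summands, encoded by the property of objects of belonging to the subcategory. -/
@[ext]
structure ThickSubcategory where
  /-- the objects of the thick subcategory -/
  mem : ObjectProperty C
  isTriangulated : mem.IsTriangulated
  isStableUnderRetracts : mem.IsStableUnderRetracts

variable {C}

/-- Thick subcategories are ordered by inclusion. -/
instance : PartialOrder (ThickSubcategory C) :=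
  PartialOrder.lift ThickSubcategory.mem (fun _ _ h => ThickSubcategory.ext h)

/-- The intersection of a collection of thick subcategories. -/
instance : InfSet (ThickSubcategory C) where
  sInf S :=
    { mem := fun X => ∀ U ∈ S, U.mem X
      isStableUnderRetracts :=
        ⟨fun r h U hU => U.isStableUnderRetracts.of_retract r (h U hU)⟩
      isTriangulated :=
        { exists_zero := ⟨_, isZero_zero C, fun U _ => by
            have := U.isTriangulated
            have := U.isStableUnderRetracts
            exact U.mem.prop_zero⟩
          isStableUnderShiftBy := fun n => ⟨fun X h U hU => by
            have := U.isTriangulated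
            exact U.mem.le_shift n X (h U hU)⟩
          ext₂' := fun T hT h₁ h₃ => ObjectProperty.le_isoClosure _ _ (fun U hU => by
            have := U.isTriangulated
            have := U.isStableUnderRetracts
            exact U.mem.ext_of_isTriangulatedClosed₂ T hT (h₁ U hU) (h₃ U hU)) } }

/-- The complete lattice of thick subcategories: infima are intersections, and the supremum of a
collection is the intersection of all the thick subcategories containing its members. -/
instance : CompleteLattice (ThickSubcategory C) :=
  completeLatticeOfInf (ThickSubcategory C) (fun _ =>
    ⟨fun U hU _ hX => hX U hU, fun _ hV X hX _ hU => hV hU X hX⟩)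

/-- `Thick(X)`: the smallest thick subcategory containing the object `X`. -/
def thick (X : C) : ThickSubcategory C := sInf {U | U.mem X}

variable (C) in
/-- `C` is finitely generated: `C = Thick(X)` for some object `X`. -/
def IsFinitelyGenerated : Prop := ∃ X : C, ∀ Y : C, (thick X).mem Y

end Thick

/-- A lattice is noetherian if it has no infinite strictly increasing chain `x₀ < x₁ < ⋯`. -/
def IsNoetherianLattice (L : Type*) [Lattice L] : Prop :=
  ¬ ∃ x : ℕ → L, ∀ n : ℕ, x n < x (n + 1)

end ThickLattice

open Pretriangulated Opposite ZeroObject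

namespace ThickLattice

section Approximation

/-! Every thick subcategory `U` is generated by one object; since the union of an increasing chain
is thick, its generator already lies in some term, where the chain stops. To find the generator, let
`X` generate `C`. Noetherianity of `Hom(-,X)` yields a map `A ⟶ X` with `A` in `U` through which
every map from `U` to `X` factors. The objects `Y` such that maps from `U` to `Y` factor through
`Thick(A)` form a thick subcategory (`factorsThick`). It contains `X`, hence everything; for `Y` in
`U`, factoring `𝟙 Y` makes `Y` a retract of an object of `Thick(A)`. -/

lemma exact_of_exact_evaluation {J A : Type*} [Category* J] [Category* A] [Abelian A]
    (S : ShortComplex (J ⥤ A)) (h : ∀ j, (S.map ((evaluation J A).obj j)).Exact) :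
    S.Exact := by
  rw [ShortComplex.exact_iff_isZero_homology]
  refine Functor.isZero _ fun j => ?_
  exact ((ShortComplex.exact_iff_isZero_homology _).1 (h j)).of_iso
    (S.mapHomologyIso ((evaluation J A).obj j)).symm

lemma additive_of_mono {C D : Type*} [Category* C] [Category* D] [Preadditive C] [Preadditive D]
    [HasPullbacks D] {F G : C ⥤ D} (i : F ⟶ G) [Mono i] [G.Additive] : F.Additive where
  map_add {X Y f g} := by
    rw [← cancel_mono (i.app Y)]
    simp

variable {C : Type u} [Category.{v} C] [Preadditive C]

lemma abelianisationProp_preadditiveYoneda [HasZeroObject C] (X : C) :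
    abelianisationProp C (preadditiveYoneda.obj X) := by
  refine ⟨inferInstance, 0, X, 0, 𝟙 _, by simp, ?_, inferInstance⟩
  exact (ShortComplex.exact_iff_mono _ rfl).2 (by dsimp; infer_instance)

variable [HasZeroObject C] [HasShift C ℤ]
  [∀ n : ℤ, (shiftFunctor C n).Additive] [Pretriangulated C]

lemma preadditiveYoneda_exact (T : Triangle C) (hT : T ∈ distTriang C)
    (w : preadditiveYoneda.map T.mor₁ ≫ preadditiveYoneda.map T.mor₂ = 0) :
    (ShortComplex.mk _ _ w).Exact := by
  refine exact_of_exact_evaluation _ fun j => (ShortComplex.ab_exact_iff _).2 fun x hx => ?_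
  obtain ⟨y, hy⟩ := Triangle.coyoneda_exact₂ T hT (X := j.unop) x hx
  exact ⟨y, hy.symm⟩

/-- Completing `f` to a triangle `K ⟶ A ⟶ X` presents the image as the cokernel of `Hom(-,K) ⟶
Hom(-,A)`. -/
lemma abelianisationProp_image {A X : C} (f : A ⟶ X) :
    abelianisationProp C (Abelian.image (preadditiveYoneda.map f)) := by
  obtain ⟨K, g, h, hT⟩ := distinguished_cocone_triangle₁ f
  have w : preadditiveYoneda.map g ≫ preadditiveYoneda.map f = 0 := by
    ext j x
    have : g ≫ f = 0 := comp_distTriang_mor_zero₁₂ _ hT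
    exact (Category.assoc (x : j.unop ⟶ K) g f).trans (this ▸ comp_zero)
  have w' : preadditiveYoneda.map g ≫ Abelian.factorThruImage (preadditiveYoneda.map f) = 0 := by
    rw [← cancel_mono (Abelian.image.ι _)]
    simpa using w
  refine ⟨additive_of_mono (Abelian.image.ι (preadditiveYoneda.map f)), K, A,
    preadditiveYoneda.map g, Abelian.factorThruImage _, w', ?_, inferInstance⟩
  let φ : ShortComplex.mk _ _ w' ⟶ ShortComplex.mk _ _ w :=
    { τ₁ := 𝟙 _
      τ₂ := 𝟙 _
      τ₃ := Abelian.image.ι _ }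
  have : Epi φ.τ₁ := inferInstanceAs (Epi (𝟙 _))
  have : IsIso φ.τ₂ := inferInstanceAs (IsIso (𝟙 _))
  have : Mono φ.τ₃ := inferInstanceAs (Mono (Abelian.image.ι _))
  exact (ShortComplex.exact_iff_of_epi_of_isIso_of_mono φ).2 (preadditiveYoneda_exact _ hT w)

/-- The functor represented by `X`, as an object of the abelianisation. -/
noncomputable def representable (X : C) : Abelianisation C :=
  ⟨preadditiveYoneda.obj X, abelianisationProp_preadditiveYoneda X⟩

/-- The inclusion of the image of `Hom(-,A) ⟶ Hom(-,X)` in the abelianisation. -/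
noncomputable def imageι {A X : C} (f : A ⟶ X) :
    (⟨Abelian.image (preadditiveYoneda.map f), abelianisationProp_image f⟩ : Abelianisation C) ⟶
      representable X :=
  ObjectProperty.homMk (Abelian.image.ι (preadditiveYoneda.map f))

instance {A X : C} (f : A ⟶ X) : Mono (imageι f) :=
  (abelianisationProp C).ι.mono_of_mono_map
    (inferInstanceAs (Mono (Abelian.image.ι (preadditiveYoneda.map f))))

/-- The image of `Hom(-,A) ⟶ Hom(-,X)`, as a subobject in the abelianisation. -/
noncomputable def imageSubobject {A X : C} (f : A ⟶ X) : Subobject (representable X) :=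
  Subobject.mk (imageι f)

lemma imageSubobject_le_of_fac {A B X : C} (f : A ⟶ X) (g : B ⟶ X) (a : A ⟶ B)
    (h : a ≫ g = f) : imageSubobject f ≤ imageSubobject g := by
  refine Subobject.mk_le_mk_of_comm (ObjectProperty.homMk
    (kernel.lift _ (Abelian.image.ι (preadditiveYoneda.map f)) ?_)) ?_
  · rw [← cancel_epi (Abelian.factorThruImage (preadditiveYoneda.map f))]
    simp [← h]
  · ext1
    exact kernel.lift_ι _ _ _

lemma exists_fac_of_imageSubobject_le {A B X : C} (f : A ⟶ X) (g : B ⟶ X)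
    (h : imageSubobject f ≤ imageSubobject g) : ∃ a : A ⟶ B, a ≫ g = f := by
  let φ := (Subobject.ofMkLEMk _ _ h).hom
  have hφ : φ ≫ Abelian.image.ι (preadditiveYoneda.map g) =
      Abelian.image.ι (preadditiveYoneda.map f) :=
    congr_arg (fun k => k.hom) (Subobject.ofMkLEMk_comp h)
  have hs := (AddCommGrpCat.epi_iff_surjective _).1
    ((NatTrans.epi_iff_epi_app (Abelian.factorThruImage (preadditiveYoneda.map g))).1
      inferInstance (op A))
  -- Yoneda: the desired lift is a preimage of the element of the image functor at `A` defined by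
  -- `f`.
  obtain ⟨a, ha⟩ := hs (φ.app (op A)
    ((Abelian.factorThruImage (preadditiveYoneda.map f)).app (op A) (𝟙 A)))
  refine ⟨a, ?_⟩
  have hf := Abelian.image.fac (preadditiveYoneda.map f)
  have hg := Abelian.image.fac (preadditiveYoneda.map g)
  have h₁ : a ≫ g = (Abelian.image.ι (preadditiveYoneda.map g)).app (op A)
      ((Abelian.factorThruImage (preadditiveYoneda.map g)).app (op A) a) :=
    (ConcreteCategory.congr_hom (NatTrans.congr_app hg (op A)) a).symm
  have h₂ : 𝟙 A ≫ f = (Abelian.image.ι (preadditiveYoneda.map f)).app (op A)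
      ((Abelian.factorThruImage (preadditiveYoneda.map f)).app (op A) (𝟙 A)) :=
    (ConcreteCategory.congr_hom (NatTrans.congr_app hf (op A)) (𝟙 A)).symm
  have h₃ := ConcreteCategory.congr_hom (NatTrans.congr_app hφ (op A))
    ((Abelian.factorThruImage (preadditiveYoneda.map f)).app (op A) (𝟙 A))
  rw [h₁, ha]
  exact h₃.trans (h₂.symm.trans (Category.id_comp f))

/-- If the functor represented by `X` is noetherian, then `X` has a right approximation by any
triangulated subcategory. -/
lemma exists_right_approximation (X : C) [IsNoetherianObject (representable X)]
    (P : ObjectProperty C) [P.IsTriangulated] [P.IsClosedUnderIsomorphisms] :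
    ∃ (A : C) (f : A ⟶ X), P A ∧ ∀ (B : C) (g : B ⟶ X), P B → ∃ a : B ⟶ A, a ≫ f = g := by
  let S : Set (Subobject (representable X)) :=
    {s | ∃ (A : C) (f : A ⟶ X), P A ∧ s = imageSubobject f}
  have hS : S.Nonempty := ⟨_, 0, 0, P.prop_zero, rfl⟩
  obtain ⟨_, ⟨A, f, hA, rfl⟩, hmax⟩ := wellFounded_gt.has_min S hS
  refine ⟨A, f, hA, fun B g hB => exists_fac_of_imageSubobject_le _ _ ?_⟩
  -- The image of `A ⊞ B` contains those of `f` and `g`, so maximality makes it equal to that of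
  -- `f`.
  have hAB : P (A ⊞ B) :=
    P.ext_of_isTriangulatedClosed₂ _ (binaryBiproductTriangle_distinguished A B) hA hB
  have hle : imageSubobject f ≤ imageSubobject (biprod.desc f g) :=
    imageSubobject_le_of_fac _ _ biprod.inl (by simp)
  have heq := hle.eq_of_not_lt (hmax _ ⟨_, _, hAB, rfl⟩)
  rw [heq]
  exact imageSubobject_le_of_fac _ _ biprod.inr (by simp)

end Approximation

section Factorization

variable {C : Type u} [Category.{v} C]

/-- The objects `Y` such that every morphism to `Y` from an object satisfying `P` factors through
an object satisfying `Q`. -/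
def factorsProp (P Q : ObjectProperty C) : ObjectProperty C := fun Y =>
  ∀ (B : C) (f : B ⟶ Y), P B → ∃ (V : C) (p : B ⟶ V) (q : V ⟶ Y), Q V ∧ p ≫ q = f

lemma factorsProp_shift [HasShift C ℤ] {P Q : ObjectProperty C} [P.IsStableUnderShift ℤ]
    [Q.IsStableUnderShift ℤ] (n : ℤ) {Y : C} (h : factorsProp P Q Y) :
    factorsProp P Q (Y⟦n⟧) := by
  intro B f hB
  let adj := (shiftEquiv C n).symm.toAdjunction
  obtain ⟨V, p, q, hV, hpq⟩ := h (B⟦-n⟧) ((adj.homEquiv B Y).symm f) (P.le_shift (-n) _ hB)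
  refine ⟨V⟦n⟧, adj.homEquiv B V p, q⟦n⟧', Q.le_shift n _ hV, ?_⟩
  rw [← Equiv.apply_symm_apply (adj.homEquiv B Y) f, ← hpq]
  exact (adj.homEquiv_naturality_right p q).symm

end Factorization

section Generation

variable {C : Type u} [Category.{v} C] [Preadditive C] [HasZeroObject C] [HasShift C ℤ]
  [∀ n : ℤ, (shiftFunctor C n).Additive] [Pretriangulated C]

instance (U : ThickSubcategory C) : U.mem.IsTriangulated := U.isTriangulated

instance (U : ThickSubcategory C) : U.mem.IsStableUnderRetracts := U.isStableUnderRetracts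

lemma thick_mem_self (X : C) : (thick X).mem X := fun _ hU => hU

lemma thick_le {X : C} {U : ThickSubcategory C} (h : U.mem X) : thick X ≤ U :=
  fun _ hY => hY U h

/-- Factor first over `T.obj₃`, then factor the induced map from the fibre `B'` to `T.obj₁`; `Q ≤ P`
keeps `B'` in `P`. Gluing the two middle objects gives an extension `E` in `Q`. -/
lemma factorsProp_ext {P Q : ObjectProperty C} [P.IsTriangulated] [Q.IsTriangulated]
    [P.IsClosedUnderIsomorphisms] [Q.IsClosedUnderIsomorphisms] (hQP : Q ≤ P)
    (T : Triangle C) (hT : T ∈ distTriang C) (h₁ : factorsProp P Q T.obj₁)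
    (h₃ : factorsProp P Q T.obj₃) : factorsProp P Q T.obj₂ := by
  intro B f hB
  obtain ⟨V₃, p, q, hV₃, hpq⟩ := h₃ B (f ≫ T.mor₂) hB
  obtain ⟨B', i, d, hT'⟩ := distinguished_cocone_triangle₁ p
  have hB' : P B' := P.ext_of_isTriangulatedClosed₁ _ hT' hB (hQP _ hV₃)
  obtain ⟨g, hg, hgd⟩ : ∃ g : B' ⟶ T.obj₁, i ≫ f = g ≫ T.mor₁ ∧ d ≫ g⟦(1 : ℤ)⟧' = q ≫ T.mor₃ :=
    complete_distinguished_triangle_morphism₁ _ T hT' hT f q hpq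
  obtain ⟨V₁, r, s, hV₁, rfl⟩ := h₁ B' g hB'
  obtain ⟨E, j, k, hE⟩ := distinguished_cocone_triangle₂ (d ≫ r⟦(1 : ℤ)⟧')
  have hE' : Q E := Q.ext_of_isTriangulatedClosed₂ _ hE hV₁ hV₃
  obtain ⟨t, ht₁, ht₂⟩ : ∃ t : B ⟶ E, i ≫ t = r ≫ j ∧ p ≫ 𝟙 V₃ = t ≫ k :=
    complete_distinguished_triangle_morphism₂ _ _ hT' hE r (𝟙 V₃) (Category.id_comp _).symm
  have hsq : (d ≫ r⟦(1 : ℤ)⟧') ≫ s⟦(1 : ℤ)⟧' = q ≫ T.mor₃ := by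
    rw [Category.assoc, ← Functor.map_comp, hgd]
  obtain ⟨h, hh₁, hh₂⟩ : ∃ h : E ⟶ T.obj₂, j ≫ h = s ≫ T.mor₁ ∧ k ≫ q = h ≫ T.mor₂ :=
    complete_distinguished_triangle_morphism₂ _ T hE hT s q hsq
  -- The map through `E` need not equal `f`, but the error vanishes on `B'`, so it factors through
  -- `V₃`; the summand `V₃` below absorbs it.
  have hz : i ≫ (f - t ≫ h) = 0 := by
    rw [Preadditive.comp_sub, hg, reassoc_of% ht₁, hh₁, Category.assoc, sub_self]
  obtain ⟨e, he⟩ : ∃ e : V₃ ⟶ T.obj₂, f - t ≫ h = p ≫ e :=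
    Triangle.yoneda_exact₂ _ hT' (f - t ≫ h) hz
  refine ⟨V₃ ⊞ E, biprod.lift p t, biprod.desc e h,
    Q.ext_of_isTriangulatedClosed₂ _ (binaryBiproductTriangle_distinguished V₃ E) hV₃ hE', ?_⟩
  rw [biprod.lift_desc, ← he, sub_add_cancel]

/-- If `V ≤ U` are thick subcategories, the objects `Y` such that every morphism from an object
of `U` to `Y` factors through an object of `V` form a thick subcategory. -/
def factorsThick {U V : ThickSubcategory C} (h : V ≤ U) : ThickSubcategory C where
  mem := factorsProp U.mem V.mem
  isStableUnderRetracts := ⟨fun r hY B f hB => by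
    obtain ⟨W, p, q, hW, hpq⟩ := hY B (f ≫ r.i) hB
    exact ⟨W, p, q ≫ r.r, hW, by rw [reassoc_of% hpq, r.retract, Category.comp_id]⟩⟩
  isTriangulated :=
    { exists_zero := ⟨_, isZero_zero C, fun _ _ _ =>
        ⟨_, 0, 0, V.mem.prop_zero, (isZero_zero C).eq_of_tgt _ _⟩⟩
      isStableUnderShiftBy := fun n => ⟨fun _ hY => factorsProp_shift n hY⟩
      ext₂' := fun T hT h₁ h₃ =>
        ObjectProperty.le_isoClosure _ _ (factorsProp_ext h T hT h₁ h₃) }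

/-- If `C = Thick(X)` where `X` represents a noetherian functor, every thick subcategory of `C` is
generated by an object. -/
lemma exists_eq_thick {X : C} (hX : ∀ Y, (thick X).mem Y) [IsNoetherianObject (representable X)]
    (U : ThickSubcategory C) : ∃ A : C, U = thick A := by
  obtain ⟨A, f, hA, hf⟩ := exists_right_approximation X U.mem
  refine ⟨A, le_antisymm (fun Y hY => ?_) (thick_le hA)⟩
  have hXF : (factorsThick (thick_le hA)).mem X := fun B g hB => by
    obtain ⟨a, ha⟩ := hf B g hB
    exact ⟨A, a, f, thick_mem_self A, ha⟩
  obtain ⟨W, p, q, hW, hpq⟩ := thick_le hXF _ (hX Y) Y (𝟙 Y) hY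
  exact (thick A).mem.prop_of_retract ⟨p, q, hpq⟩ hW

/-- The union of an increasing sequence of thick subcategories. -/
def iUnionThick (U : ℕ → ThickSubcategory C) (hU : Monotone U) : ThickSubcategory C where
  mem := fun Y => ∃ n, (U n).mem Y
  isStableUnderRetracts := ⟨fun r ⟨n, hn⟩ => ⟨n, (U n).mem.prop_of_retract r hn⟩⟩
  isTriangulated :=
    { exists_zero := ⟨_, isZero_zero C, 0, (U 0).mem.prop_zero⟩
      isStableUnderShiftBy := fun k => ⟨fun Y ⟨n, hn⟩ => ⟨n, (U n).mem.le_shift k Y hn⟩⟩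
      ext₂' := fun T hT ⟨m, hm⟩ ⟨n, hn⟩ => ObjectProperty.le_isoClosure _ _
        ⟨max m n, (U _).mem.ext_of_isTriangulatedClosed₂ T hT
          (hU (le_max_left m n) _ hm) (hU (le_max_right m n) _ hn)⟩ }

end Generation

end ThickLattice

theorem proposition4p2 (C : Type u) [Category.{v} C] [Preadditive C] [HasZeroObject C]
    [HasShift C ℤ] [∀ n : ℤ, (shiftFunctor C n).Additive] [Pretriangulated C] [IsTriangulated C]
    [EssentiallySmall.{v} C]
    (hfg : ThickLattice.IsFinitelyGenerated C)
    (hnoeth : ThickLattice.IsLocallyNoetherian C) :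
    ThickLattice.IsNoetherianLattice (ThickLattice.ThickSubcategory C) := by
  rintro ⟨U, hU⟩
  obtain ⟨X, hX⟩ := hfg
  have := hnoeth.isNoetherianObject (ThickLattice.representable X)
  have hmono : StrictMono U := strictMono_nat_of_lt_succ hU
  obtain ⟨A, hA⟩ := ThickLattice.exists_eq_thick hX (ThickLattice.iUnionThick U hmono.monotone)
  obtain ⟨n, hn⟩ : (ThickLattice.iUnionThick U hmono.monotone).mem A :=
    hA ▸ ThickLattice.thick_mem_self A
  have hle : U (n + 1) ≤ U n := fun Y hY => by
    have hY' : (ThickLattice.iUnionThick U hmono.monotone).mem Y := ⟨n + 1, hY⟩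
    rw [hA] at hY'
    exact ThickLattice.thick_le hn Y hY'
  exact (hU n).not_ge hle
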